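/- Let $V:\mathbb{Z}\to\mathbb{R}$ be bounded and let $H$ be the one-dimensional discrete Schrödinger operator on $\ell^2(\mathbb{Z})=\ell^2(\mathbb{Z};\mathbb{C})$ given by \[ (Hu)(n)=u(n+1)+u(n-1)+V(n)\,u(n),\qquad n\in\mathbb{Z}. \] Let $\sigma_{\mathrm{ess}}(H)\subset\mathbb{R}$ be the essential spectrum of the bounded self-adjoint operator $H$, that is, the spectrum of $H$ with the isolated points that are eigenvalues of finite multiplicity removed. Then $\sigma_{\mathrm{ess}}(H)$ is non-empty and bounded, and \[ \sup\sigma_{\mathrm{ess}}(H)-\inf\sigma_{\mathrm{ess}}(H)\ \ge\ 4 . \] Moreover, equality holds if and only if there is a constant $V_\infty\in\mathbb{R}$ such that $V(n)\to V_\infty$ as $|n|\to\infty$. -/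

import Mathlib

open Filter Topology

noncomputable section

/-- The complex Hilbert space `ℓ²(ℤ)`. -/
abbrev EllTwo : Type := lp (fun _ : ℤ => ℂ) 2

/-- Square-summability is preserved by translations of `ℤ`. -/
theorem memℓp_ellTwoShift (k : ℤ) (u : EllTwo) :
    Memℓp (fun n : ℤ => u (n + k)) 2 := by
  have h := (memℓp_gen_iff (p := 2) (by norm_num)).1 (lp.memℓp u)
  exact (memℓp_gen_iff (by norm_num)).2 ((Equiv.addRight k).summable_iff.2 h)

/-- The translation `(S u)(n) = u(n + k)` on `ℓ²(ℤ)`. -/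
def ellTwoShift (k : ℤ) : EllTwo →L[ℂ] EllTwo :=
  LinearMap.mkContinuous
    { toFun := fun u => ⟨fun n => u (n + k), memℓp_ellTwoShift k u⟩
      map_add' := fun _ _ => rfl
      map_smul' := fun _ _ => rfl } 1 (by
    intro u
    rw [one_mul]
    refine le_of_eq ?_
    rw [lp.norm_eq_tsum_rpow (by norm_num), lp.norm_eq_tsum_rpow (by norm_num)]
    congr 1
    exact (Equiv.addRight k).tsum_eq (fun n => ‖u n‖ ^ (2 : ENNReal).toReal))

/-- A bounded potential preserves square-summability. -/
theorem memℓp_potential (V : ℤ → ℝ) (hV : ∃ C, ∀ n, |V n| ≤ C) (u : EllTwo) :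
    Memℓp (fun n : ℤ => (V n : ℂ) * u n) 2 := by
  obtain ⟨C, hC⟩ := hV
  refine ((lp.memℓp u).const_mul (C : ℂ)).mono' (fun n => ?_)
  rw [norm_mul, norm_mul, Complex.norm_real, Complex.norm_real, Real.norm_eq_abs, Real.norm_eq_abs]
  exact mul_le_mul_of_nonneg_right ((hC n).trans (le_abs_self C)) (norm_nonneg _)

/-- Multiplication by a bounded real potential, `(V u)(n) = V(n) u(n)`, on `ℓ²(ℤ)`. -/
def ellTwoMul (V : ℤ → ℝ) (hV : ∃ C, ∀ n, |V n| ≤ C) : EllTwo →L[ℂ] EllTwo :=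
  LinearMap.mkContinuousOfExistsBound
    { toFun := fun u => ⟨fun n => (V n : ℂ) * u n, memℓp_potential V hV u⟩
      map_add' := fun u v => by ext n; exact mul_add _ _ _
      map_smul' := fun c u => by ext n; exact mul_left_comm _ _ _ } (by
    obtain ⟨C, hC⟩ := hV
    refine ⟨|C|, fun u => ?_⟩
    have h : ‖(C : ℂ) • u‖ = |C| * ‖u‖ := by
      rw [norm_smul, Complex.norm_real, Real.norm_eq_abs]
    rw [← h]
    refine lp.norm_mono (by norm_num) (fun n => ?_)
    simp only [LinearMap.coe_mk, AddHom.coe_mk, lp.coeFn_smul, Pi.smul_apply, smul_eq_mul,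
      norm_mul, Complex.norm_real, Real.norm_eq_abs]
    exact mul_le_mul_of_nonneg_right ((hC n).trans (le_abs_self C)) (norm_nonneg _))

/-- The one-dimensional discrete Schrödinger operator on `ℓ²(ℤ)` with bounded potential `V`. -/
def discreteSchrodinger (V : ℤ → ℝ) (hV : ∃ C, ∀ n, |V n| ≤ C) : EllTwo →L[ℂ] EllTwo :=
  ellTwoShift 1 + ellTwoShift (-1) + ellTwoMul V hV

/-- `(H u)(n) = u(n + 1) + u(n - 1) + V(n) u(n)`. -/
theorem discreteSchrodinger_apply (V : ℤ → ℝ) (hV : ∃ C, ∀ n, |V n| ≤ C) (u : EllTwo) (n : ℤ) :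
    discreteSchrodinger V hV u n = u (n + 1) + u (n - 1) + (V n : ℂ) * u n := rfl

/-- Discrete Schrödinger operators are self-adjoint, so their spectrum is real. -/
theorem discreteSchrodinger_isSelfAdjoint (V : ℤ → ℝ) (hV : ∃ C, ∀ n, |V n| ≤ C) :
    IsSelfAdjoint (discreteSchrodinger V hV) := by
  rw [ContinuousLinearMap.isSelfAdjoint_iff_isSymmetric]
  have ht : ∀ (k : ℤ) (u v : EllTwo),
      inner ℂ (ellTwoShift k u) v = inner ℂ u (ellTwoShift (-k) v) := by
    intro k u v
    rw [lp.inner_eq_tsum, lp.inner_eq_tsum]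
    rw [← (Equiv.addRight k).tsum_eq (fun n => inner ℂ (u n) (ellTwoShift (-k) v n))]
    refine tsum_congr (fun n => ?_)
    change inner ℂ (u (n + k)) (v n) = inner ℂ (u (n + k)) (v (n + k + -k))
    rw [add_neg_cancel_right]
  have hp : ∀ u v : EllTwo,
      inner ℂ (ellTwoMul V hV u) v = inner ℂ u (ellTwoMul V hV v) := by
    intro u v
    rw [lp.inner_eq_tsum, lp.inner_eq_tsum]
    refine tsum_congr (fun n => ?_)
    change inner ℂ ((V n : ℂ) * u n) (v n) = inner ℂ (u n) ((V n : ℂ) * v n)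
    simp only [RCLike.inner_apply, map_mul, Complex.conj_ofReal]
    ring
  intro u v
  change inner ℂ (ellTwoShift 1 u + ellTwoShift (-1) u + ellTwoMul V hV u) v
    = inner ℂ u (ellTwoShift 1 v + ellTwoShift (-1) v + ellTwoMul V hV v)
  have h1 := ht 1 u v
  have h2 := ht (-1) u v
  rw [neg_neg] at h2
  simp only [inner_add_left, inner_add_right, h1, h2, hp]
  ring

/-- The discrete spectrum of a bounded self-adjoint operator `T` on a complex Hilbert space: the
isolated points of the spectrum that are eigenvalues of finite multiplicity. As the spectrum of a
self-adjoint operator is real, it is taken as a set of reals. -/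
def discreteSpectrum {E : Type*} [NormedAddCommGroup E] [InnerProductSpace ℂ E]
    (T : E →L[ℂ] E) : Set ℝ :=
  {x | x ∈ spectrum ℝ T ∧ (∃ ε > 0, ∀ y ∈ spectrum ℝ T, |y - x| < ε → y = x) ∧
    Module.End.HasEigenvalue (T : E →ₗ[ℂ] E) (x : ℂ) ∧
    FiniteDimensional ℂ (Module.End.eigenspace (T : E →ₗ[ℂ] E) (x : ℂ))}

/-- The essential spectrum of a bounded self-adjoint operator `T` on a complex Hilbert space:
the spectrum with the isolated eigenvalues of finite multiplicity removed. -/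
def essentialSpectrum {E : Type*} [NormedAddCommGroup E] [InnerProductSpace ℂ E]
    (T : E →L[ℂ] E) : Set ℝ :=
  spectrum ℝ T \ discreteSpectrum T

end

/-! If the essential spectrum lies in [m, M], then m ≤ H ≤ M up to arbitrarily small constants and
finite-rank operators, and the latter are small on vectors vanishing on a large finite set. Write ∇u
= Su − u with S the shift by 1. The form of H is 2‖u‖² − ‖∇u‖² + ⟨u, Vu⟩, and conjugation by (−1)ⁿ
flips the sign of its kinetic part, so far out V is squeezed from both sides
(`exists_finset_form_bounds`). Subtracting the two bounds cancels V and leaves 4 ≤ M − m when tested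
on wide tents translated far out.

If M − m = 4 with midpoint c, then B = V − c satisfies ±⟨u, Bu⟩ ≤ ‖∇u‖² + ε‖u‖² far out. A
first-order test controls only averages of B; the trial vectors 4φ ± Bφ control ‖Bφ‖ itself
(`norm_sq_le_of_form_bounds`), and a translated tent φ then gives pointwise decay.

Conversely, if V → c and |x − c| > 2, then H − x is bounded below on a subspace of finite
codimension, which excludes x (`notMem_essentialSpectrum_of_le_norm`). -/

/-- The indicator function of a closed set `K` is continuous on `s` as soon as the points of
`s ∩ K` are isolated in `s`. -/
theorem continuousOn_indicator_of_isolated {s K : Set ℝ} (hK : IsClosed K)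
    (hs : ∀ x ∈ s ∩ K, ∃ ε > 0, ∀ y ∈ s, |y - x| < ε → y = x) :
    ContinuousOn (K.indicator (fun _ => (1 : ℝ))) s := by
  intro x hx
  by_cases hxK : x ∈ K
  · obtain ⟨ε, hε, h⟩ := hs x ⟨hx, hxK⟩
    refine continuousWithinAt_const.congr_of_eventuallyEq (f := fun _ => (1 : ℝ)) ?_
      (Set.indicator_of_mem hxK _)
    filter_upwards [self_mem_nhdsWithin, mem_nhdsWithin_of_mem_nhds (Metric.ball_mem_nhds x hε)]
      with y hy hyx
    rw [h y hy hyx, Set.indicator_of_mem hxK]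
  · refine continuousWithinAt_const.congr_of_eventuallyEq (f := fun _ => (0 : ℝ)) ?_
      (Set.indicator_of_notMem hxK _)
    filter_upwards [mem_nhdsWithin_of_mem_nhds (hK.isOpen_compl.mem_nhds hxK)] with y hy
    exact Set.indicator_of_notMem hy _

theorem finite_of_isCompact_of_isolated {s : Set ℝ} (hc : IsCompact s)
    (hs : ∀ x ∈ s, ∃ ε > 0, ∀ y ∈ s, |y - x| < ε → y = x) : s.Finite := by
  choose! ε hε h using hs
  obtain ⟨t, hts, ht⟩ := hc.elim_nhds_subcover (fun x => Metric.ball x (ε x))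
    (fun x hx => Metric.ball_mem_nhds x (hε x hx))
  refine t.finite_toSet.subset (fun y hy => ?_)
  obtain ⟨x, hx, hyx⟩ := Set.mem_iUnion₂.1 (ht hy)
  rw [h x (hts x hx) y hy hyx]
  exact hx

/-! ### Functional calculus and the essential spectrum -/

section SelfAdjoint

variable {E : Type*} [NormedAddCommGroup E] [InnerProductSpace ℂ E] [CompleteSpace E]
  {T : E →L[ℂ] E}

theorem cfc_mul_self_apply (hT : IsSelfAdjoint T) {f : ℝ → ℝ}
    (hf : ContinuousOn f (spectrum ℝ T)) (u : E) :
    T (cfc f T u) = cfc (fun t => t * f t) T u := by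
  have h := cfc_mul (fun t : ℝ => t) f T (by fun_prop) hf
  rw [cfc_id' ℝ T] at h
  rw [h]; rfl

/-- The spectral projection of an isolated point maps into the eigenspace. -/
theorem cfc_indicator_singleton_mem_eigenspace (hT : IsSelfAdjoint T) {x : ℝ}
    (hx : ContinuousOn (({x} : Set ℝ).indicator (fun _ => (1 : ℝ))) (spectrum ℝ T)) (u : E) :
    cfc (({x} : Set ℝ).indicator (fun _ => (1 : ℝ))) T u ∈
      Module.End.eigenspace (T : E →ₗ[ℂ] E) (x : ℂ) := by
  rw [Module.End.mem_eigenspace_iff]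
  change T (cfc (({x} : Set ℝ).indicator (fun _ => (1 : ℝ))) T u) = _
  rw [cfc_mul_self_apply hT hx]
  have h : (fun t => t * ({x} : Set ℝ).indicator (fun _ => (1 : ℝ)) t) =
      fun t => x * ({x} : Set ℝ).indicator (fun _ => (1 : ℝ)) t := by
    funext t
    by_cases ht : t = x
    · rw [ht]
    · rw [Set.indicator_of_notMem (by simpa using ht), mul_zero, mul_zero]
  rw [h, cfc_const_mul x _ T hx, smul_apply, Complex.coe_smul]

/-- If a closed set does not meet the essential spectrum, its indicator function is continuous on
the spectrum. -/
theorem continuousOn_indicator_of_disjoint_essentialSpectrum {E : Type*} [NormedAddCommGroup E]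
    [InnerProductSpace ℂ E] {T : E →L[ℂ] E} {K : Set ℝ} (hK : IsClosed K)
    (hKT : Disjoint (essentialSpectrum T) K) :
    ContinuousOn (K.indicator (fun _ => (1 : ℝ))) (spectrum ℝ T) := by
  refine continuousOn_indicator_of_isolated hK (fun x hx => ?_)
  by_contra h
  exact Set.disjoint_left.1 hKT ⟨hx.1, fun hd => h hd.2.1⟩ hx.2

/-- If a closed set does not meet the essential spectrum, its spectral projection has finite
rank. -/
theorem finiteDimensional_range_cfc_indicator (hT : IsSelfAdjoint T) {K : Set ℝ}
    (hK : IsClosed K) (hKT : Disjoint (essentialSpectrum T) K) :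
    FiniteDimensional ℂ
      (LinearMap.range ((cfc (K.indicator (fun _ => (1 : ℝ))) T : E →L[ℂ] E) : E →ₗ[ℂ] E)) := by
  have hdisc : ∀ x ∈ spectrum ℝ T ∩ K, x ∈ discreteSpectrum T := by
    intro x hx
    by_contra h
    exact Set.disjoint_left.1 hKT ⟨hx.1, h⟩ hx.2
  have hfin : (spectrum ℝ T ∩ K).Finite := by
    refine finite_of_isCompact_of_isolated ((spectrum.isCompact T).inter_right hK) ?_
    intro x hx
    obtain ⟨ε, hε, h⟩ := (hdisc x hx).2.1
    exact ⟨ε, hε, fun y hy => h y hy.1⟩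
  have hcont : ∀ x ∈ spectrum ℝ T ∩ K,
      ContinuousOn (({x} : Set ℝ).indicator (fun _ => (1 : ℝ))) (spectrum ℝ T) := by
    intro x hx
    refine continuousOn_indicator_of_isolated isClosed_singleton ?_
    rintro y ⟨-, rfl⟩
    exact (hdisc y hx).2.1
  have hsum : cfc (K.indicator (fun _ => (1 : ℝ))) T =
      ∑ x ∈ hfin.toFinset, cfc (({x} : Set ℝ).indicator (fun _ => (1 : ℝ))) T := by
    rw [← cfc_sum _ _ _ (fun x hx => hcont x (hfin.mem_toFinset.1 hx))]
    refine cfc_congr (fun t ht => ?_)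
    rw [Finset.sum_apply]
    by_cases htK : t ∈ K
    · rw [Set.indicator_of_mem htK, Finset.sum_eq_single_of_mem t (hfin.mem_toFinset.2 ⟨ht, htK⟩),
        Set.indicator_of_mem (Set.mem_singleton t)]
      intro y _ hy
      exact Set.indicator_of_notMem (fun h => hy (Set.mem_singleton_iff.1 h).symm) _
    · rw [Set.indicator_of_notMem htK, Finset.sum_eq_zero]
      intro y hy
      refine Set.indicator_of_notMem (fun h => htK ?_) _
      rw [Set.mem_singleton_iff.1 h]
      exact (hfin.mem_toFinset.1 hy).2
  have : Finite (spectrum ℝ T ∩ K : Set ℝ) := hfin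
  have (x : (spectrum ℝ T ∩ K : Set ℝ)) :
      FiniteDimensional ℂ (Module.End.eigenspace (T : E →ₗ[ℂ] E) ((x : ℝ) : ℂ)) :=
    (hdisc x x.2).2.2.2
  refine Submodule.finiteDimensional_of_le (S₂ := ⨆ x : (spectrum ℝ T ∩ K : Set ℝ),
    Module.End.eigenspace (T : E →ₗ[ℂ] E) ((x : ℝ) : ℂ)) ?_
  rintro _ ⟨u, rfl⟩
  rw [hsum]
  change (∑ x ∈ hfin.toFinset, cfc (({x} : Set ℝ).indicator (fun _ => (1 : ℝ))) T) u ∈ _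
  rw [sum_apply]
  refine Submodule.sum_mem _ (fun x hx => ?_)
  have hx' := hfin.mem_toFinset.1 hx
  exact Submodule.mem_iSup_of_mem (⟨x, hx'⟩ : (spectrum ℝ T ∩ K : Set ℝ))
    (cfc_indicator_singleton_mem_eigenspace hT (hcont x hx') u)

theorem re_inner_cfc_le (hT : IsSelfAdjoint T) {f g : ℝ → ℝ}
    (hf : ContinuousOn f (spectrum ℝ T)) (hg : ContinuousOn g (spectrum ℝ T))
    (hfg : ∀ x ∈ spectrum ℝ T, f x ≤ g x) (u : E) :
    (inner ℂ u (cfc f T u)).re ≤ (inner ℂ u (cfc g T u)).re := by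
  have h := (cfc_le_iff f g T hf hg hT).2 hfg
  rw [ContinuousLinearMap.le_def] at h
  have h' := h.re_inner_nonneg_right u
  rw [sub_apply, inner_sub_right, map_sub] at h'
  exact sub_nonneg.1 h'

/-- If the essential spectrum lies below `M`, then `T ≤ M` up to an operator of finite rank. -/
theorem exists_finiteRank_re_inner_le (hT : IsSelfAdjoint T) {M : ℝ}
    (hM : ∀ x ∈ essentialSpectrum T, x < M) :
    ∃ P : E →L[ℂ] E, FiniteDimensional ℂ (LinearMap.range (P : E →ₗ[ℂ] E)) ∧
      ∀ u, (inner ℂ u (T u)).re ≤ M * ‖u‖ ^ 2 + (inner ℂ u (P u)).re := by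
  have hd : Disjoint (essentialSpectrum T) (Set.Ici M) :=
    Set.disjoint_left.2 (fun x hx hxM => (hM x hx).not_ge hxM)
  have hc := continuousOn_indicator_of_disjoint_essentialSpectrum isClosed_Ici hd
  have hfin := finiteDimensional_range_cfc_indicator hT isClosed_Ici hd
  obtain ⟨C, hC⟩ := (spectrum.isCompact (𝕜 := ℝ) T).bddAbove
  set P := cfc ((Set.Ici M).indicator (fun _ => (1 : ℝ))) T with hP
  -- Since `C` bounds the spectrum above, t ≤ M + (C − M)·1_{[M,∞)}(t) holds there.
  refine ⟨(((C - M : ℝ)) : ℂ) • P, Submodule.finiteDimensional_of_le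
    (S₂ := LinearMap.range (P : E →ₗ[ℂ] E)) ?_, fun u => ?_⟩
  · rintro _ ⟨u, rfl⟩
    exact ⟨((C - M : ℝ) : ℂ) • u, map_smul P _ u⟩
  · have h := re_inner_cfc_le hT (f := fun t => t)
      (g := fun t => M + (C - M) * (Set.Ici M).indicator (fun _ => (1 : ℝ)) t)
      (by fun_prop) (by fun_prop) (fun x hx => ?_) u
    · rw [cfc_id' ℝ T, cfc_const_add M _ T (by fun_prop), cfc_const_mul _ _ T hc, ← hP,
        add_apply, inner_add_right, Algebra.algebraMap_eq_smul_one,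
        Complex.add_re] at h
      refine h.trans_eq ?_
      congr 1
      rw [smul_apply, one_apply_eq_self, ← Complex.coe_smul,
        inner_smul_right, Complex.re_ofReal_mul]
      exact congrArg _ (inner_self_eq_norm_sq (𝕜 := ℂ) u)
    · by_cases hxM : x ∈ Set.Ici M
      · simp only [Set.indicator_of_mem hxM]
        linarith [hC hx]
      · simp only [Set.indicator_of_notMem hxM]
        linarith [not_le.1 (Set.mem_Ici.not.1 hxM)]

/-- If the essential spectrum lies above `m`, then `m ≤ T` up to an operator of finite rank. -/
theorem exists_finiteRank_le_re_inner (hT : IsSelfAdjoint T) {m : ℝ}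
    (hm : ∀ x ∈ essentialSpectrum T, m < x) :
    ∃ P : E →L[ℂ] E, FiniteDimensional ℂ (LinearMap.range (P : E →ₗ[ℂ] E)) ∧
      ∀ u, m * ‖u‖ ^ 2 + (inner ℂ u (P u)).re ≤ (inner ℂ u (T u)).re := by
  have hd : Disjoint (essentialSpectrum T) (Set.Iic m) :=
    Set.disjoint_left.2 (fun x hx hxM => (hm x hx).not_ge hxM)
  have hc := continuousOn_indicator_of_disjoint_essentialSpectrum isClosed_Iic hd
  have hfin := finiteDimensional_range_cfc_indicator hT isClosed_Iic hd
  obtain ⟨C, hC⟩ := (spectrum.isCompact (𝕜 := ℝ) T).bddBelow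
  set P := cfc ((Set.Iic m).indicator (fun _ => (1 : ℝ))) T with hP
  refine ⟨(((C - m : ℝ)) : ℂ) • P, Submodule.finiteDimensional_of_le
    (S₂ := LinearMap.range (P : E →ₗ[ℂ] E)) ?_, fun u => ?_⟩
  · rintro _ ⟨u, rfl⟩
    exact ⟨((C - m : ℝ) : ℂ) • u, map_smul P _ u⟩
  · have h := re_inner_cfc_le hT (g := fun t => t)
      (f := fun t => m + (C - m) * (Set.Iic m).indicator (fun _ => (1 : ℝ)) t)
      (by fun_prop) (by fun_prop) (fun x hx => ?_) u
    · rw [cfc_id' ℝ T, cfc_const_add m _ T (by fun_prop), cfc_const_mul _ _ T hc, ← hP,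
        add_apply, inner_add_right, Algebra.algebraMap_eq_smul_one,
        Complex.add_re] at h
      refine le_of_eq_of_le ?_ h
      congr 1
      rw [smul_apply, one_apply_eq_self, ← Complex.coe_smul,
        inner_smul_right, Complex.re_ofReal_mul]
      exact congrArg _ (inner_self_eq_norm_sq (𝕜 := ℂ) u).symm
    · by_cases hxM : x ∈ Set.Iic m
      · simp only [Set.indicator_of_mem hxM]
        linarith [hC hx]
      · simp only [Set.indicator_of_notMem hxM]
        linarith [not_le.1 (Set.mem_Iic.not.1 hxM)]

/-- If `T - x` is bounded below on a subspace of finite codimension, then `x` does not belong to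
the essential spectrum of `T`. -/
theorem notMem_essentialSpectrum_of_le_norm (hT : IsSelfAdjoint T) {F : Type*} [AddCommGroup F]
    [Module ℂ F] [FiniteDimensional ℂ F] (Q : E →ₗ[ℂ] F) {x η : ℝ} (hη : 0 < η)
    (hQ : ∀ u, Q u = 0 → η * ‖u‖ ≤ ‖T u - (x : ℂ) • u‖) :
    x ∉ essentialSpectrum T := by
  rintro ⟨hxT, hx⟩
  -- On such an `R` the kernel of `Q` is trivial, since η‖u‖ ≤ (η/2)‖u‖ forces u = 0.
  have hfd : ∀ R : Submodule ℂ E, (∀ u ∈ R, ‖T u - (x : ℂ) • u‖ ≤ η / 2 * ‖u‖) →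
      FiniteDimensional ℂ R := by
    intro R hR
    refine FiniteDimensional.of_injective (Q.domRestrict R)
      ((injective_iff_map_eq_zero _).2 (fun u hu => ?_))
    have h := (hQ u hu).trans (hR u u.2)
    have h' : ‖(u : E)‖ ≤ 0 := by nlinarith [norm_nonneg (u : E)]
    exact Subtype.ext (norm_le_zero_iff.1 h')
  set h : ℝ → ℝ := fun t => max 0 (η / 2 - |t - x|) with hh
  have hcont : Continuous h := by fun_prop
  set R : Submodule ℂ E := LinearMap.range ((cfc h T : E →L[ℂ] E) : E →ₗ[ℂ] E) with hRdef
  have hRfd : FiniteDimensional ℂ R := by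
    refine hfd R ?_
    rintro _ ⟨w, rfl⟩
    -- The truncation `g` agrees with t − x wherever `h` is nonzero, and is bounded by η/2
    -- everywhere.
    set g : ℝ → ℝ := fun t => max (-(η / 2)) (min (η / 2) (t - x)) with hg
    have hgc : Continuous g := by fun_prop
    have hgh : ∀ t, t * h t = x * h t + g t * h t := by
      intro t
      rcases le_total (η / 2) |t - x| with ht | ht
      · have : h t = 0 := max_eq_left (by linarith)
        rw [this]; ring
      · have : g t = t - x := by
          rw [abs_le] at ht
          simp only [hg]
          rw [min_eq_right ht.2, max_eq_right ht.1]
        rw [this]; ring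
    have h1 : T (cfc h T w) - (x : ℂ) • (cfc h T w) = cfc g T (cfc h T w) := by
      rw [cfc_mul_self_apply hT hcont.continuousOn, funext hgh,
        cfc_add T (fun t => x * h t) (fun t => g t * h t) (by fun_prop) (by fun_prop),
        cfc_const_mul x h T (by fun_prop), cfc_mul g h T (by fun_prop) (by fun_prop),
        Complex.coe_smul]
      simp
    change ‖T (cfc h T w) - (x : ℂ) • (cfc h T w)‖ ≤ η / 2 * ‖cfc h T w‖
    rw [h1]
    refine (cfc g T).le_of_opNorm_le (norm_cfc_le (by positivity) (fun t _ => ?_)) _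
    rw [Real.norm_eq_abs, abs_le]
    exact ⟨le_max_left _ _, max_le (by linarith) (min_le_left _ _)⟩
  -- The spectrum near `x` consists of roots of a polynomial.
  obtain ⟨p, hp0, hp⟩ : ∃ p : Polynomial ℝ, p ≠ 0 ∧
      ∀ t ∈ spectrum ℝ T, p.eval t * h t = 0 := by
    have hRT : ∀ u ∈ R.restrictScalars ℝ, ((T : E →ₗ[ℂ] E).restrictScalars ℝ) u ∈
        R.restrictScalars ℝ := by
      rintro _ ⟨w, rfl⟩
      refine ⟨T w, ?_⟩
      have hcomm := cfc_commute_cfc (fun t : ℝ => t) h T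
      rw [cfc_id' ℝ T] at hcomm
      exact (congrArg (fun A : E →L[ℂ] E => A w) hcomm.eq).symm
    have : FiniteDimensional ℝ (R.restrictScalars ℝ) :=
      inferInstanceAs (FiniteDimensional ℝ R)
    -- Scalars are restricted to ℝ so that the minimal polynomial is real and fits the real
    -- functional calculus.
    set A := ((T : E →ₗ[ℂ] E).restrictScalars ℝ).restrict hRT with hA
    refine ⟨minpoly ℝ A, minpoly.ne_zero (Algebra.IsIntegral.isIntegral A), ?_⟩
    set p := minpoly ℝ A with hpdef
    have hApow : ∀ (n : ℕ) (v : R.restrictScalars ℝ), (((A ^ n) v : _) : E) = (T ^ n) (v : E) := by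
      intro n
      induction n with
      | zero => intro v; rfl
      | succ n ih =>
        intro v
        rw [pow_succ, pow_succ, Module.End.mul_apply, ih, mul_apply_eq_comp]
        rfl
    have hker : Polynomial.aeval T p * cfc h T = 0 := by
      ext w
      have hz : Polynomial.aeval A p (⟨cfc h T w, ⟨w, rfl⟩⟩ : R.restrictScalars ℝ) = 0 := by
        rw [hpdef, minpoly.aeval]; rfl
      have hz' := congrArg (Subtype.val) hz
      rw [Polynomial.aeval_eq_sum_range, LinearMap.sum_apply] at hz'
      rw [mul_apply_eq_comp, Polynomial.aeval_eq_sum_range,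
        sum_apply]
      refine Eq.trans ?_ hz'
      rw [AddSubmonoidClass.coe_finsetSum]
      refine Finset.sum_congr rfl (fun n _ => ?_)
      rw [LinearMap.smul_apply, smul_apply, Submodule.coe_smul, hApow]
    rw [← cfc_polynomial p T, ← cfc_mul _ h T (by fun_prop) (by fun_prop),
      ← cfc_zero ℝ T, cfc_eq_cfc_iff_eqOn] at hker
    intro t ht
    simpa using hker ht
  have hiso : ∃ ε > 0, ∀ y ∈ spectrum ℝ T, |y - x| < ε → y = x := by
    have hfin : {t | p.eval t = 0}.Finite := by
      refine p.roots.toFinset.finite_toSet.subset (fun t ht => ?_)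
      simpa [hp0] using ht
    obtain ⟨ε, hε, hball⟩ := Metric.isOpen_iff.1
      (hfin.subset (Set.sdiff_subset (t := {x}))).isClosed.isOpen_compl x (by simp)
    -- Radius η/2 keeps `h y` positive, so `y` is a root of `p`; radius `ε` excludes every root
    -- other than `x`.
    refine ⟨min ε (η / 2), by positivity, fun y hy hyx => ?_⟩
    by_contra hne
    have hpos : 0 < h y := lt_max_of_lt_right (by linarith [hyx.trans_le (min_le_right ε (η / 2))])
    exact hball (show y ∈ Metric.ball x ε from hyx.trans_le (min_le_left _ _))
      ⟨(mul_eq_zero.1 (hp y hy)).resolve_right hpos.ne', hne⟩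
  refine hx ⟨hxT, hiso, ?_, hfd _ ?_⟩
  · have hc : ContinuousOn (({x} : Set ℝ).indicator (fun _ => (1 : ℝ))) (spectrum ℝ T) := by
      refine continuousOn_indicator_of_isolated isClosed_singleton ?_
      rintro y ⟨-, rfl⟩
      exact hiso
    intro hbot
    -- With no eigenvector the spectral projection at `x` would vanish, although its symbol is 1 at
    -- `x` in the spectrum.
    have hz : cfc (({x} : Set ℝ).indicator (fun _ => (1 : ℝ))) T = cfc (0 : ℝ → ℝ) T := by
      rw [cfc_zero ℝ T]
      ext u
      have := cfc_indicator_singleton_mem_eigenspace hT hc u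
      rw [Module.End.eigenspace, hbot] at this
      exact this
    have := (cfc_eq_cfc_iff_eqOn hT hc (by fun_prop)).1 hz hxT
    simp at this
  · intro u hu
    rw [Module.End.mem_eigenspace_iff] at hu
    have hu' : T u = (x : ℂ) • u := hu
    rw [hu', sub_self, norm_zero]
    positivity

end SelfAdjoint

/-! ### Quadratic forms on ℓ²(ℤ) far from the origin -/

section EllTwo

/-- A vector of `ℓ²(ℤ)` is almost orthogonal to every vector supported far out. -/
theorem exists_finset_norm_inner_le (v : EllTwo) {δ : ℝ} (hδ : 0 < δ) :
    ∃ s : Finset ℤ, ∀ u : EllTwo, (∀ n ∈ s, u n = 0) → ‖inner ℂ v u‖ ≤ δ * ‖u‖ := by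
  obtain ⟨s, hs⟩ := ((Metric.tendsto_nhds.1 (lp.hasSum_single (p := 2) (by norm_num) v)) δ hδ).exists
  refine ⟨s, fun u hu => ?_⟩
  have h0 : inner ℂ (∑ n ∈ s, lp.single 2 n (v n)) u = 0 := by
    rw [sum_inner]
    refine Finset.sum_eq_zero (fun n hn => ?_)
    rw [lp.inner_single_left, hu n hn, inner_zero_right]
  have h1 : inner ℂ v u = inner ℂ (v - ∑ n ∈ s, lp.single 2 n (v n)) u := by
    rw [inner_sub_left, h0, sub_zero]
  rw [h1]
  refine (norm_inner_le_norm _ _).trans (mul_le_mul_of_nonneg_right ?_ (norm_nonneg u))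
  rw [dist_comm, dist_eq_norm] at hs
  exact hs.le

/-- A finite-rank operator on `ℓ²(ℤ)` is small on vectors supported far out. -/
theorem exists_finset_norm_apply_le (P : EllTwo →L[ℂ] EllTwo)
    [FiniteDimensional ℂ (LinearMap.range (P : EllTwo →ₗ[ℂ] EllTwo))] {δ : ℝ} (hδ : 0 < δ) :
    ∃ s : Finset ℤ, ∀ u : EllTwo, (∀ n ∈ s, u n = 0) → ‖P u‖ ≤ δ * ‖u‖ := by
  set b := stdOrthonormalBasis ℂ (LinearMap.range (P : EllTwo →ₗ[ℂ] EllTwo))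
  set d := Module.finrank ℂ (LinearMap.range (P : EllTwo →ₗ[ℂ] EllTwo))
  choose s hs using fun i : Fin d =>
    exists_finset_norm_inner_le (ContinuousLinearMap.adjoint P (b i : EllTwo))
      (show 0 < δ / (d + 1) by positivity)
  refine ⟨Finset.univ.biUnion s, fun u hu => ?_⟩
  -- The coefficients of `P u` in an orthonormal basis of the range are inner products of `u` with
  -- the fixed vectors P*bᵢ.
  have h := b.sum_repr' ⟨P u, ⟨u, rfl⟩⟩
  have h' : P u = ∑ i, inner ℂ (ContinuousLinearMap.adjoint P (b i : EllTwo)) u •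
      (b i : EllTwo) := by
    have := congrArg Subtype.val h
    rw [AddSubmonoidClass.coe_finsetSum] at this
    rw [← show _ = P u from this]
    refine Finset.sum_congr rfl (fun i _ => ?_)
    rw [ContinuousLinearMap.adjoint_inner_left]
    rfl
  rw [h']
  calc ‖∑ i, inner ℂ (ContinuousLinearMap.adjoint P (b i : EllTwo)) u • (b i : EllTwo)‖
      ≤ ∑ _i : Fin d, δ / (d + 1) * ‖u‖ := by
        refine norm_sum_le_of_le _ (fun i _ => ?_)
        rw [norm_smul, show ‖(b i : EllTwo)‖ = 1 from b.orthonormal.1 i, mul_one]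
        exact hs i u (fun n hn => hu n (Finset.mem_biUnion.2 ⟨i, Finset.mem_univ i, hn⟩))
    _ = d / (d + 1) * (δ * ‖u‖) := by
        rw [Finset.sum_const, Finset.card_univ, Fintype.card_fin, nsmul_eq_mul]
        ring
    _ ≤ δ * ‖u‖ := by
        refine mul_le_of_le_one_left (by positivity) ?_
        rw [div_le_one (by positivity)]
        linarith

/-- Bounds on the essential spectrum bound the quadratic form on vectors supported far out. -/
theorem exists_finset_re_inner_bounds {T : EllTwo →L[ℂ] EllTwo} (hT : IsSelfAdjoint T) {m M : ℝ}
    (hm : ∀ x ∈ essentialSpectrum T, m ≤ x) (hM : ∀ x ∈ essentialSpectrum T, x ≤ M)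
    {ε : ℝ} (hε : 0 < ε) :
    ∃ s : Finset ℤ, ∀ u : EllTwo, (∀ n ∈ s, u n = 0) →
      (m - ε) * ‖u‖ ^ 2 ≤ (inner ℂ u (T u)).re ∧ (inner ℂ u (T u)).re ≤ (M + ε) * ‖u‖ ^ 2 := by
  obtain ⟨P, hPfin, hP⟩ := exists_finiteRank_re_inner_le hT (M := M + ε / 2)
    (fun x hx => by linarith [hM x hx])
  obtain ⟨P', hPfin', hP'⟩ := exists_finiteRank_le_re_inner hT (m := m - ε / 2)
    (fun x hx => by linarith [hm x hx])
  obtain ⟨s, hs⟩ := exists_finset_norm_apply_le P (half_pos hε)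
  obtain ⟨s', hs'⟩ := exists_finset_norm_apply_le P' (half_pos hε)
  have key : ∀ (A : EllTwo →L[ℂ] EllTwo) (u : EllTwo), ‖A u‖ ≤ ε / 2 * ‖u‖ →
      |(inner ℂ u (A u)).re| ≤ ε / 2 * ‖u‖ ^ 2 := by
    intro A u hA
    calc |(inner ℂ u (A u)).re| ≤ ‖u‖ * ‖A u‖ :=
          (Complex.abs_re_le_norm _).trans (norm_inner_le_norm _ _)
      _ ≤ ‖u‖ * (ε / 2 * ‖u‖) := by gcongr
      _ = ε / 2 * ‖u‖ ^ 2 := by ring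
  refine ⟨s ∪ s', fun u hu => ⟨?_, ?_⟩⟩
  · have h := (abs_le.1 (key P' u (hs' u (fun n hn => hu n (Finset.mem_union_right _ hn))))).1
    linarith [hP' u]
  · have h := (abs_le.1 (key P u (hs u (fun n hn => hu n (Finset.mem_union_left _ hn))))).2
    linarith [hP u]

theorem ellTwo_norm_sq_eq_tsum (u : EllTwo) : ‖u‖ ^ 2 = ∑' n, ‖u n‖ ^ 2 := by
  simpa using lp.norm_rpow_eq_tsum (p := 2) (by norm_num) u

theorem norm_ellTwoShift (k : ℤ) (u : EllTwo) : ‖ellTwoShift k u‖ = ‖u‖ := by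
  rw [← sq_eq_sq₀ (norm_nonneg _) (norm_nonneg _), ellTwo_norm_sq_eq_tsum, ellTwo_norm_sq_eq_tsum]
  exact (Equiv.addRight k).tsum_eq (fun n => ‖u n‖ ^ 2)

theorem inner_ellTwoShift_left (k : ℤ) (u v : EllTwo) :
    inner ℂ (ellTwoShift k u) v = inner ℂ u (ellTwoShift (-k) v) := by
  rw [lp.inner_eq_tsum, lp.inner_eq_tsum,
    ← (Equiv.addRight k).tsum_eq (fun n => inner ℂ (u n) (ellTwoShift (-k) v n))]
  refine tsum_congr (fun n => ?_)
  change inner ℂ (u (n + k)) (v n) = inner ℂ (u (n + k)) (v (n + k + -k))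
  rw [add_neg_cancel_right]

theorem inner_ellTwoMul_left (V : ℤ → ℝ) (hV : ∃ C, ∀ n, |V n| ≤ C) (u v : EllTwo) :
    inner ℂ (ellTwoMul V hV u) v = inner ℂ u (ellTwoMul V hV v) := by
  rw [lp.inner_eq_tsum, lp.inner_eq_tsum]
  refine tsum_congr (fun n => ?_)
  change inner ℂ ((V n : ℂ) * u n) (v n) = inner ℂ (u n) ((V n : ℂ) * v n)
  simp only [RCLike.inner_apply, map_mul, Complex.conj_ofReal]
  ring

/-- The kinetic energy in terms of the discrete gradient. -/
theorem re_inner_ellTwoShift_add (u : EllTwo) :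
    (inner ℂ u (ellTwoShift 1 u + ellTwoShift (-1) u)).re =
      2 * ‖u‖ ^ 2 - ‖ellTwoShift 1 u - u‖ ^ 2 := by
  have h := norm_sub_sq (𝕜 := ℂ) (ellTwoShift 1 u) u
  have h1 : (inner ℂ u (ellTwoShift 1 u)).re = (inner ℂ (ellTwoShift 1 u) u).re :=
    inner_re_symm (𝕜 := ℂ) _ _
  have h2 : RCLike.re (inner ℂ (ellTwoShift 1 u) u) = (inner ℂ (ellTwoShift 1 u) u).re := rfl
  rw [norm_ellTwoShift, h2] at h
  rw [inner_add_right, Complex.add_re, ← inner_ellTwoShift_left, h1]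
  linarith

theorem re_inner_discreteSchrodinger (V : ℤ → ℝ) (hV : ∃ C, ∀ n, |V n| ≤ C) (u : EllTwo) :
    (inner ℂ u (discreteSchrodinger V hV u)).re =
      2 * ‖u‖ ^ 2 - ‖ellTwoShift 1 u - u‖ ^ 2 + (inner ℂ u (ellTwoMul V hV u)).re := by
  rw [← re_inner_ellTwoShift_add, ← Complex.add_re, ← inner_add_right]
  rfl

/-- Conjugation by the alternating sign `(-1)ⁿ` reverses the sign of the kinetic energy. -/
theorem exists_alternating (V : ℤ → ℝ) (hV : ∃ C, ∀ n, |V n| ≤ C) (u : EllTwo) :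
    ∃ v : EllTwo, ‖v‖ = ‖u‖ ∧ (∀ n, u n = 0 → v n = 0) ∧
      (inner ℂ v (discreteSchrodinger V hV v)).re =
        -(2 * ‖u‖ ^ 2 - ‖ellTwoShift 1 u - u‖ ^ 2) + (inner ℂ u (ellTwoMul V hV u)).re := by
  have hw : ∃ C : ℝ, ∀ n : ℤ, |(-1 : ℝ) ^ n| ≤ C := ⟨1, fun n => by simp [abs_zpow]⟩
  have hsq : ∀ n : ℤ, (((-1 : ℝ) ^ n : ℝ) : ℂ) * (((-1 : ℝ) ^ n : ℝ) : ℂ) = 1 := by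
    intro n
    rw [← Complex.ofReal_mul, ← mul_zpow]
    simp
  refine ⟨ellTwoMul (fun n => (-1 : ℝ) ^ n) hw u, ?_, ?_, ?_⟩
  · rw [← sq_eq_sq₀ (norm_nonneg _) (norm_nonneg _), ellTwo_norm_sq_eq_tsum,
      ellTwo_norm_sq_eq_tsum]
    refine tsum_congr (fun n => ?_)
    change ‖(((-1 : ℝ) ^ n : ℝ) : ℂ) * u n‖ ^ 2 = _
    rw [norm_mul, Complex.norm_real, Real.norm_eq_abs, abs_zpow]
    simp
  · intro n hn
    change (((-1 : ℝ) ^ n : ℝ) : ℂ) * u n = 0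
    rw [hn, mul_zero]
  · have h : discreteSchrodinger V hV (ellTwoMul (fun n => (-1 : ℝ) ^ n) hw u) =
        ellTwoMul (fun n => (-1 : ℝ) ^ n) hw
          (ellTwoMul V hV u - (ellTwoShift 1 u + ellTwoShift (-1) u)) := by
      ext n
      change (((-1 : ℝ) ^ (n + 1) : ℝ) : ℂ) * u (n + 1)
          + (((-1 : ℝ) ^ (n + -1) : ℝ) : ℂ) * u (n + -1)
          + (V n : ℂ) * ((((-1 : ℝ) ^ n : ℝ) : ℂ) * u n) =
        (((-1 : ℝ) ^ n : ℝ) : ℂ) * ((V n : ℂ) * u n - (u (n + 1) + u (n + -1)))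
      rw [zpow_add₀ (by norm_num), zpow_add₀ (by norm_num)]
      push_cast
      norm_num
      ring
    have h2 : ∀ v : EllTwo, ellTwoMul (fun n => (-1 : ℝ) ^ n) hw
        (ellTwoMul (fun n => (-1 : ℝ) ^ n) hw v) = v := by
      intro v
      ext n
      change (((-1 : ℝ) ^ n : ℝ) : ℂ) * ((((-1 : ℝ) ^ n : ℝ) : ℂ) * v n) = v n
      rw [← mul_assoc, hsq, one_mul]
    rw [h, inner_ellTwoMul_left, h2, inner_sub_right, Complex.sub_re, re_inner_ellTwoShift_add]
    ring

/-- Tent functions: finitely supported vectors of height `1` with small discrete gradient. -/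
theorem exists_tent {δ : ℝ} (hδ : 0 < δ) :
    ∃ (ψ : EllTwo) (t : Finset ℤ), ψ 0 = 1 ∧ (∀ n ∉ t, ψ n = 0) ∧
      ‖ellTwoShift 1 ψ - ψ‖ ^ 2 ≤ δ := by
  -- At most 2L + 2 differences, each at most 1/L, give (2L + 2)/L² ≤ 4/L < δ.
  obtain ⟨L, hL⟩ := exists_nat_gt (max 1 (4 / δ))
  have hL1 : (1 : ℝ) < L := (le_max_left _ _).trans_lt hL
  have hLδ : 4 / δ < L := (le_max_right _ _).trans_lt hL
  set f : ℤ → ℝ := fun n => max (1 - |(n : ℝ)| / L) 0 with hf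
  have hf0 : ∀ n : ℤ, n ∉ Finset.Icc (-(L : ℤ)) L → f n = 0 := by
    intro n hn
    refine max_eq_right ?_
    rw [Finset.mem_Icc, ← abs_le, not_le] at hn
    have : (L : ℝ) < |(n : ℝ)| := by exact_mod_cast hn
    rw [sub_nonpos, le_div_iff₀ (by linarith)]
    linarith
  have hmem : Memℓp (fun n : ℤ => (f n : ℂ)) 2 := by
    refine (memℓp_zero ((Finset.Icc (-(L : ℤ)) L).finite_toSet.subset ?_)).of_exponent_ge
      zero_le
    intro n hn
    by_contra h
    exact hn (by simp [hf0 n h])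
  refine ⟨⟨fun n => (f n : ℂ), hmem⟩, Finset.Icc (-(L : ℤ)) L, ?_, ?_, ?_⟩
  · change (f 0 : ℂ) = 1
    simp [hf]
  · intro n hn
    change (f n : ℂ) = 0
    rw [hf0 n hn, Complex.ofReal_zero]
  · rw [ellTwo_norm_sq_eq_tsum]
    change ∑' n : ℤ, ‖(f (n + 1) : ℂ) - (f n : ℂ)‖ ^ 2 ≤ δ
    -- The difference at n also reads n + 1, so its support may start one site earlier.
    rw [tsum_eq_sum (s := Finset.Icc (-(L : ℤ) - 1) L)]
    · have hterm : ∀ n ∈ Finset.Icc (-(L : ℤ) - 1) L,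
          ‖(f (n + 1) : ℂ) - (f n : ℂ)‖ ^ 2 ≤ (1 / (L : ℝ)) ^ 2 := by
        intro n _
        refine pow_le_pow_left₀ (norm_nonneg _) ?_ 2
        rw [← Complex.ofReal_sub, Complex.norm_real, Real.norm_eq_abs]
        refine (abs_max_sub_max_le_abs _ _ _).trans ?_
        have h1 : (1 - |((n + 1 : ℤ) : ℝ)| / (L : ℝ)) - (1 - |(n : ℝ)| / L) =
            (|(n : ℝ)| - |((n + 1 : ℤ) : ℝ)|) / L := by ring
        rw [h1, abs_div, abs_of_pos (show (0 : ℝ) < L by linarith)]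
        gcongr
        refine (abs_abs_sub_abs_le_abs_sub _ _).trans ?_
        push_cast
        simp
      refine (Finset.sum_le_sum hterm).trans ?_
      rw [Finset.sum_const, Int.card_Icc, nsmul_eq_mul,
        show ((L : ℤ) + 1 - (-(L : ℤ) - 1)).toNat = 2 * L + 2 by omega]
      push_cast
      rw [div_lt_iff₀ hδ] at hLδ
      rw [one_div, inv_pow, ← div_eq_mul_inv, div_le_iff₀ (by positivity)]
      nlinarith
    · intro n hn
      rw [Finset.mem_Icc] at hn
      rw [hf0 n (by rw [Finset.mem_Icc]; omega), hf0 (n + 1) (by rw [Finset.mem_Icc]; omega)]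
      simp

end EllTwo

/-! ### The abstract variational estimate -/

theorem re_inner_add_sub_re_inner_sub {E : Type*} [NormedAddCommGroup E] [InnerProductSpace ℂ E]
    (B : E →L[ℂ] E) (hB : ∀ u v, inner ℂ (B u) v = inner ℂ u (B v)) (a b : E) :
    (inner ℂ (a + b) (B (a + b))).re - (inner ℂ (a - b) (B (a - b))).re =
      4 * (inner ℂ a (B b)).re := by
  have h : (inner ℂ b (B a)).re = (inner ℂ a (B b)).re := by
    rw [← hB]
    exact inner_re_symm (𝕜 := ℂ) _ _
  simp only [map_add, map_sub, inner_add_left, inner_add_right, inner_sub_left, inner_sub_right,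
    Complex.add_re, Complex.sub_re, h]
  ring

/-- The second-order variational estimate: if `±B` is dominated by the Dirichlet form of the
isometry `S` along the trial vectors `4φ ± Bφ`, then `Bφ` is small. -/
theorem norm_sq_le_of_form_bounds {E : Type*} [NormedAddCommGroup E] [InnerProductSpace ℂ E]
    (S B : E →L[ℂ] E) (hS : ∀ u, ‖S u‖ = ‖u‖) (hB : ∀ u v, inner ℂ (B u) v = inner ℂ u (B v))
    (φ : E) {ε : ℝ} (hε : ε ≤ 1)
    (hp : (inner ℂ ((4 : ℂ) • φ + B φ) (B ((4 : ℂ) • φ + B φ))).re ≤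
      ‖S ((4 : ℂ) • φ + B φ) - ((4 : ℂ) • φ + B φ)‖ ^ 2 + ε * ‖(4 : ℂ) • φ + B φ‖ ^ 2)
    (hm : -(inner ℂ ((4 : ℂ) • φ - B φ) (B ((4 : ℂ) • φ - B φ))).re ≤
      ‖S ((4 : ℂ) • φ - B φ) - ((4 : ℂ) • φ - B φ)‖ ^ 2 + ε * ‖(4 : ℂ) • φ - B φ‖ ^ 2) :
    ‖B φ‖ ^ 2 ≤ 6 * (‖S φ - φ‖ ^ 2 + ε * ‖φ‖ ^ 2) := by
  have h1 := re_inner_add_sub_re_inner_sub B hB ((4 : ℂ) • φ) (B φ)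
  have h2 : (inner ℂ ((4 : ℂ) • φ) (B (B φ))).re = 4 * ‖B φ‖ ^ 2 := by
    rw [← hB, map_smul, inner_smul_left, Complex.conj_ofNat, ← inner_self_eq_norm_sq (𝕜 := ℂ) (B φ)]
    exact Complex.re_ofReal_mul 4 _
  have h4 : ‖(4 : ℂ) • φ‖ = 4 * ‖φ‖ := by rw [norm_smul]; norm_num
  have h3 := parallelogram_law_with_norm ℂ ((4 : ℂ) • φ) (B φ)
  have h5 := parallelogram_law_with_norm ℂ ((4 : ℂ) • (S φ - φ)) (S (B φ) - B φ)
  have h6 : ‖(4 : ℂ) • (S φ - φ)‖ = 4 * ‖S φ - φ‖ := by rw [norm_smul]; norm_num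
  have e1 : S ((4 : ℂ) • φ + B φ) - ((4 : ℂ) • φ + B φ) =
      (4 : ℂ) • (S φ - φ) + (S (B φ) - B φ) := by
    rw [map_add, map_smul, smul_sub]; abel
  have e2 : S ((4 : ℂ) • φ - B φ) - ((4 : ℂ) • φ - B φ) =
      (4 : ℂ) • (S φ - φ) - (S (B φ) - B φ) := by
    rw [map_sub, map_smul, smul_sub]; abel
  have h7 : ‖S (B φ) - B φ‖ ^ 2 ≤ 4 * ‖B φ‖ ^ 2 := by
    have h := norm_sub_le (S (B φ)) (B φ)
    rw [hS] at h
    nlinarith [norm_nonneg (S (B φ) - B φ)]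
  rw [e1] at hp
  rw [e2] at hm
  rw [h4] at h3
  rw [h6] at h5
  rw [h2] at h1
  have h8 : ε * (‖(4 : ℂ) • φ + B φ‖ ^ 2 + ‖(4 : ℂ) • φ - B φ‖ ^ 2) =
      32 * (ε * ‖φ‖ ^ 2) + 2 * (ε * ‖B φ‖ ^ 2) := by
    rw [h3]; ring
  have h9 : ε * ‖B φ‖ ^ 2 ≤ ‖B φ‖ ^ 2 := mul_le_of_le_one_left (sq_nonneg _) hε
  -- Adding `hp` and `hm` gives 16‖Bφ‖² ≤ 32(‖Sφ − φ‖² + ε‖φ‖²) + (8 + 2)‖Bφ‖²; the factor 4 in the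
  -- trial vectors makes the left side win, and 32/6 ≤ 6.
  nlinarith [sq_nonneg ‖S φ - φ‖, sq_nonneg ‖B φ‖]

/-! ### Spectral width and the potential at infinity -/

section Schrodinger

variable (V : ℤ → ℝ) (hV : ∃ C, ∀ n, |V n| ≤ C)

theorem exists_abs_sub_le {V : ℤ → ℝ} (hV : ∃ C, ∀ n, |V n| ≤ C) (c : ℝ) :
    ∃ C, ∀ n, |V n - c| ≤ C := by
  obtain ⟨C, hC⟩ := hV
  exact ⟨C + |c|, fun n => (abs_sub _ _).trans (by linarith [hC n])⟩

theorem ellTwoMul_eq_sub_add (c : ℝ) (u : EllTwo) :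
    ellTwoMul V hV u = ellTwoMul (fun n => V n - c) (exists_abs_sub_le hV c) u + (c : ℂ) • u := by
  ext n
  change (V n : ℂ) * u n = ((V n - c : ℝ) : ℂ) * u n + (c : ℂ) * u n
  push_cast
  ring

theorem re_inner_ellTwoMul_eq_sub_add (c : ℝ) (u : EllTwo) :
    (inner ℂ u (ellTwoMul V hV u)).re =
      (inner ℂ u (ellTwoMul (fun n => V n - c) (exists_abs_sub_le hV c) u)).re + c * ‖u‖ ^ 2 := by
  rw [ellTwoMul_eq_sub_add V hV c, inner_add_right, Complex.add_re, inner_smul_right,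
    Complex.re_ofReal_mul]
  exact congrArg _ (congrArg _ (inner_self_eq_norm_sq (𝕜 := ℂ) u))

/-- Bounds on the essential spectrum, expressed through the discrete gradient. -/
theorem exists_finset_form_bounds {m M : ℝ}
    (hm : ∀ x ∈ essentialSpectrum (discreteSchrodinger V hV), m ≤ x)
    (hM : ∀ x ∈ essentialSpectrum (discreteSchrodinger V hV), x ≤ M) {ε : ℝ} (hε : 0 < ε) :
    ∃ s : Finset ℤ, ∀ u : EllTwo, (∀ n ∈ s, u n = 0) →
      2 * ‖u‖ ^ 2 - ‖ellTwoShift 1 u - u‖ ^ 2 + (inner ℂ u (ellTwoMul V hV u)).re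
        ≤ (M + ε) * ‖u‖ ^ 2 ∧
      (m - ε) * ‖u‖ ^ 2 ≤
        -(2 * ‖u‖ ^ 2 - ‖ellTwoShift 1 u - u‖ ^ 2) + (inner ℂ u (ellTwoMul V hV u)).re := by
  obtain ⟨s, hs⟩ := exists_finset_re_inner_bounds (discreteSchrodinger_isSelfAdjoint V hV) hm hM hε
  refine ⟨s, fun u hu => ⟨?_, ?_⟩⟩
  · rw [← re_inner_discreteSchrodinger]
    exact (hs u hu).2
  · obtain ⟨v, hv, hv0, hvH⟩ := exists_alternating V hV u
    rw [← hvH, ← hv]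
    exact (hs v (fun n hn => hv0 n (hu n hn))).1

/-- A finitely supported vector can be translated off any finite set by all but finitely many
translations. -/
theorem eventually_cofinite_ellTwoShift_eq_zero {ψ : EllTwo} {t : Finset ℤ}
    (ht : ∀ n ∉ t, ψ n = 0) (s : Finset ℤ) :
    ∀ᶠ k : ℤ in cofinite, ∀ n ∈ s, ellTwoShift (-k) ψ n = 0 := by
  rw [eventually_cofinite]
  refine (Finset.image₂ (fun n l => n - l) s t).finite_toSet.subset (fun k hk => ?_)
  simp only [Set.mem_ofPred_eq, not_forall] at hk
  obtain ⟨n, hn, h⟩ := hk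
  refine Finset.mem_coe.2 (Finset.mem_image₂.2 ⟨n, hn, n + -k, ?_, by ring⟩)
  by_contra hnt
  exact h (ht _ hnt)

theorem norm_ellTwoShift_gradient (k : ℤ) (ψ : EllTwo) :
    ‖ellTwoShift 1 (ellTwoShift k ψ) - ellTwoShift k ψ‖ = ‖ellTwoShift 1 ψ - ψ‖ := by
  rw [← norm_ellTwoShift k (ellTwoShift 1 ψ - ψ), map_sub]
  congr 2
  ext n
  change ψ (n + 1 + k) = ψ (n + k + 1)
  rw [add_right_comm]

/-- The potential cancels between the upper form bound and the sign-flipped lower one, so only the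
kinetic energy of a flat vector matters. -/
theorem four_le_of_essentialSpectrum_subset {m M : ℝ}
    (hm : ∀ x ∈ essentialSpectrum (discreteSchrodinger V hV), m ≤ x)
    (hM : ∀ x ∈ essentialSpectrum (discreteSchrodinger V hV), x ≤ M) : 4 ≤ M - m := by
  refine le_of_forall_pos_le_add (fun δ hδ => ?_)
  -- The gradient and the form error each enter twice, for a total of δ; ‖ψ‖ ≥ 1 absorbs the
  -- gradient term into δ‖ψ‖².
  obtain ⟨ψ, t, hψ0, ht, hψ⟩ := exists_tent (show 0 < δ / 4 by positivity)
  obtain ⟨s, hs⟩ := exists_finset_form_bounds V hV hm hM (show 0 < δ / 4 by positivity)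
  obtain ⟨k, hk⟩ := (eventually_cofinite_ellTwoShift_eq_zero ht s).exists
  obtain ⟨h1, h2⟩ := hs _ hk
  rw [norm_ellTwoShift_gradient, norm_ellTwoShift] at h1 h2
  have hn : 1 ≤ ‖ψ‖ := by
    have := lp.norm_apply_le_norm (p := 2) (by norm_num) ψ 0
    rwa [hψ0, norm_one] at this
  have hn2 : 1 ≤ ‖ψ‖ ^ 2 := one_le_pow₀ hn
  by_contra hcon
  have : 0 < 4 - (M - m) - δ := by linarith
  nlinarith

/-- For an empty set the bounds m = M = 0 hold vacuously, contradicting the width estimate. -/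
theorem essentialSpectrum_discreteSchrodinger_nonempty :
    (essentialSpectrum (discreteSchrodinger V hV)).Nonempty := by
  by_contra h
  rw [Set.not_nonempty_iff_eq_empty] at h
  have := four_le_of_essentialSpectrum_subset V hV (m := 0) (M := 0) (by simp [h]) (by simp [h])
  norm_num at this

/-- If the essential spectrum lies in an interval of length `4`, the potential converges to its
midpoint. -/
theorem tendsto_of_essentialSpectrum_subset {c : ℝ}
    (hm : ∀ x ∈ essentialSpectrum (discreteSchrodinger V hV), c - 2 ≤ x)
    (hM : ∀ x ∈ essentialSpectrum (discreteSchrodinger V hV), x ≤ c + 2) :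
    Tendsto V cofinite (𝓝 c) := by
  rw [Metric.tendsto_nhds]
  intro τ hτ
  -- Gradient and `ε` terms of τ²/24 each give ‖Bφ‖² ≤ 6 · τ²/12 = τ²/2 < τ².
  obtain ⟨ψ, t, hψ0, ht, hψ⟩ := exists_tent (show 0 < τ ^ 2 / 24 by positivity)
  set ε : ℝ := min 1 (τ ^ 2 / (24 * (‖ψ‖ ^ 2 + 1))) with hεdef
  have hε : 0 < ε := by positivity
  obtain ⟨s, hs⟩ := exists_finset_form_bounds V hV hm hM hε
  filter_upwards [eventually_cofinite_ellTwoShift_eq_zero ht s] with k hk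
  set φ := ellTwoShift (-k) ψ with hφ
  set B := ellTwoMul (fun n => V n - c) (exists_abs_sub_le hV c) with hB
  have hB0 : ∀ n ∈ s, B φ n = 0 := by
    intro n hn
    change ((V n - c : ℝ) : ℂ) * φ n = 0
    rw [hk n hn, mul_zero]
  have hp := (hs ((4 : ℂ) • φ + B φ) (fun n hn => by
    change (4 : ℂ) * φ n + B φ n = 0
    rw [hk n hn, hB0 n hn]; simp)).1
  have hq := (hs ((4 : ℂ) • φ - B φ) (fun n hn => by
    change (4 : ℂ) * φ n - B φ n = 0
    rw [hk n hn, hB0 n hn]; simp)).2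
  rw [re_inner_ellTwoMul_eq_sub_add V hV c] at hp hq
  -- The bounds c ± 2 exactly cancel the terms ±2‖u‖² and c‖u‖², leaving ±⟨u, Bu⟩ ≤ ‖∇u‖² + ε‖u‖².
  have h := norm_sq_le_of_form_bounds (ellTwoShift 1) B (norm_ellTwoShift 1)
    (inner_ellTwoMul_left _ _) φ (ε := ε) (min_le_left _ _) (by linarith) (by linarith)
  rw [hφ, norm_ellTwoShift_gradient, norm_ellTwoShift, ← hφ] at h
  have hεψ : ε * ‖ψ‖ ^ 2 ≤ τ ^ 2 / 24 := by
    calc ε * ‖ψ‖ ^ 2 ≤ τ ^ 2 / (24 * (‖ψ‖ ^ 2 + 1)) * (‖ψ‖ ^ 2 + 1) := by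
          gcongr
          · exact min_le_right _ _
          · linarith
      _ = τ ^ 2 / 24 := by field_simp
  have hval : |V k - c| ≤ ‖B φ‖ := by
    have h' := lp.norm_apply_le_norm (p := 2) (by norm_num) (B φ) k
    have h'' : B φ k = ((V k - c : ℝ) : ℂ) := by
      change ((V k - c : ℝ) : ℂ) * ψ (k + -k) = _
      rw [add_neg_cancel, hψ0, mul_one]
    rwa [h'', Complex.norm_real, Real.norm_eq_abs] at h'
  rw [Real.dist_eq]
  refine lt_of_pow_lt_pow_left₀ 2 hτ.le ?_
  have := pow_le_pow_left₀ (abs_nonneg _) hval 2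
  have hτ2 : 0 < τ ^ 2 := by positivity
  linarith

/-- If the potential converges to `c`, the essential spectrum lies in `[c - 2, c + 2]`. -/
theorem abs_sub_le_two_of_tendsto {c : ℝ} (hc : Tendsto V cofinite (𝓝 c)) :
    ∀ x ∈ essentialSpectrum (discreteSchrodinger V hV), |x - c| ≤ 2 := by
  intro x hx
  by_contra! hcon
  -- The two shifts cost 2 and V − c costs `η` off a finite set, so |x − c| = 2 + 2η leaves a lower
  -- bound `η` for H − x.
  set η := (|x - c| - 2) / 2 with hηdef
  have hη : 0 < η := by linarith
  have hfin : {n | ¬ dist (V n) c < η}.Finite :=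
    eventually_cofinite.1 (Metric.tendsto_nhds.1 hc η hη)
  let Q : EllTwo →ₗ[ℂ] (hfin.toFinset → ℂ) :=
    { toFun := fun u n => u n
      map_add' := fun _ _ => rfl
      map_smul' := fun _ _ => rfl }
  refine notMem_essentialSpectrum_of_le_norm (discreteSchrodinger_isSelfAdjoint V hV) Q hη
    (fun u hu => ?_) hx
  have hu0 : ∀ n, ¬ dist (V n) c < η → u n = 0 := fun n hn =>
    congrFun hu ⟨n, hfin.mem_toFinset.2 hn⟩
  set B := ellTwoMul (fun n => V n - c) (exists_abs_sub_le hV c)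
  have hBu : ‖B u‖ ≤ η * ‖u‖ := by
    have h : ‖(η : ℂ) • u‖ = η * ‖u‖ := by
      rw [norm_smul, Complex.norm_real, Real.norm_eq_abs, abs_of_pos hη]
    rw [← h]
    refine lp.norm_mono (by norm_num) (fun n => ?_)
    change ‖((V n - c : ℝ) : ℂ) * u n‖ ≤ ‖(η : ℂ) * u n‖
    by_cases hn : dist (V n) c < η
    · rw [norm_mul, norm_mul, Complex.norm_real, Complex.norm_real, Real.norm_eq_abs,
        Real.norm_eq_abs, abs_of_pos hη]
      exact mul_le_mul_of_nonneg_right hn.le (norm_nonneg _)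
    · rw [hu0 n hn, mul_zero, mul_zero]
  have hdecomp : ((x - c : ℝ) : ℂ) • u = ellTwoShift 1 u + ellTwoShift (-1) u + B u -
      (discreteSchrodinger V hV u - (x : ℂ) • u) := by
    change _ = _ - (ellTwoShift 1 u + ellTwoShift (-1) u + ellTwoMul V hV u - _)
    rw [ellTwoMul_eq_sub_add V hV c u, Complex.ofReal_sub, sub_smul]
    abel
  have hnorm : ‖((x - c : ℝ) : ℂ) • u‖ = |x - c| * ‖u‖ := by
    rw [norm_smul, Complex.norm_real, Real.norm_eq_abs]
  have h1 := norm_sub_le (ellTwoShift 1 u + ellTwoShift (-1) u + B u)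
    (discreteSchrodinger V hV u - (x : ℂ) • u)
  rw [← hdecomp, hnorm] at h1
  have h2 := norm_add₃_le (a := ellTwoShift 1 u) (b := ellTwoShift (-1) u) (c := B u)
  rw [norm_ellTwoShift, norm_ellTwoShift] at h2
  have h3 : |x - c| = 2 * η + 2 := by rw [hηdef]; ring
  rw [h3] at h1
  linarith

end Schrodinger

theorem corollary4 (V : ℤ → ℝ) (hV : ∃ C, ∀ n, |V n| ≤ C) :
    (essentialSpectrum (discreteSchrodinger V hV)).Nonempty ∧
    BddAbove (essentialSpectrum (discreteSchrodinger V hV)) ∧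
    BddBelow (essentialSpectrum (discreteSchrodinger V hV)) ∧
    4 ≤ sSup (essentialSpectrum (discreteSchrodinger V hV))
      - sInf (essentialSpectrum (discreteSchrodinger V hV)) ∧
    (sSup (essentialSpectrum (discreteSchrodinger V hV))
        - sInf (essentialSpectrum (discreteSchrodinger V hV)) = 4 ↔
      ∃ Vinf : ℝ, Tendsto V (atBot ⊔ atTop) (𝓝 Vinf)) := by
  have hne := essentialSpectrum_discreteSchrodinger_nonempty V hV
  have hcpt := spectrum.isCompact (𝕜 := ℝ) (discreteSchrodinger V hV)
  have ha : BddAbove (essentialSpectrum (discreteSchrodinger V hV)) :=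
    hcpt.bddAbove.mono Set.sdiff_subset
  have hb : BddBelow (essentialSpectrum (discreteSchrodinger V hV)) :=
    hcpt.bddBelow.mono Set.sdiff_subset
  have h4 := four_le_of_essentialSpectrum_subset V hV (fun x hx => csInf_le hb hx)
    (fun x hx => le_csSup ha hx)
  refine ⟨hne, ha, hb, h4, ?_⟩
  rw [← Int.cofinite_eq]
  constructor
  · intro h
    -- The limit must be the midpoint of the spectral interval of length 4.
    refine ⟨sInf (essentialSpectrum (discreteSchrodinger V hV)) + 2,
      tendsto_of_essentialSpectrum_subset V hV (fun x hx => ?_) (fun x hx => ?_)⟩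
    · linarith [csInf_le hb hx]
    · linarith [le_csSup ha hx]
  · rintro ⟨c, hc⟩
    have h := abs_sub_le_two_of_tendsto V hV hc
    refine le_antisymm ?_ h4
    have h1 : sSup (essentialSpectrum (discreteSchrodinger V hV)) ≤ c + 2 :=
      csSup_le hne (fun x hx => by linarith [(abs_le.1 (h x hx)).2])
    have h2 : c - 2 ≤ sInf (essentialSpectrum (discreteSchrodinger V hV)) :=
      le_csInf hne (fun x hx => by linarith [(abs_le.1 (h x hx)).1])
    linarith
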